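/- Let $(A_n)_{n\ge 0}$ and $(B_n)_{n\ge 0}$ be i.i.d. sequences of nonnegative random variables, mutually independent, let $W_0\ge 0$ be independent of $(A_n)_{n\ge0}$ and $(B_{n+1})_{n\ge0}$, and define the waiting times of the server by $$W_{n+1}=\max\{0,\,B_{n+1}-A_n-W_n\},\qquad n\ge 0 .$$ The common law of the service times $A_n$ is arbitrary, and the preparation times $B_n$ have the mixed-Erlang distribution function $$\mathbb P[B_n\le x]=\sum_{n=1}^N\kappa_n\Bigl(1-e^{-\mu x}\sum_{j=0}^{n-1}\frac{(\mu x)^j}{j!}\Bigr),\qquad x\ge 0,$$ where $\mu>0$, $\kappa_n\ge 0$ and $\sum_{n=1}^N\kappa_n=1$. Then $W_n$ converges in distribution to a random variable $W$ whose law is the unique probability law with $W\stackrel{d}{=}\max\{0,B-A-W\}$, where $A$, $B$, $W$ on the right are independent and $A$, $B$ are distributed as $A_n$, $B_n$. Let $\phi(s)=\mathbb E[e^{-sW}]\,\mathbb E[e^{-sA}]$; it is infinitely differentiable at $\mu$, and $\phi^{(i)}$ denotes its $i$-th derivative. The law of $W$ has mass $p_0$ at zero, given by $$p_0=\mathbb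 P[B<W+A]=1-\sum_{n=1}^N\sum_{i=0}^{n-1}\kappa_n\frac{(-\mu)^i}{i!}\,\phi^{(i)}(\mu)$$ (with $A,B,W$ independent), and apart from this atom it has on $[0,\infty)$ the nonnegative density $$f_W(x)=\sum_{n=1}^N\kappa_n\Bigl(\mu^n e^{-\mu x}\sum_{i=0}^{n-1}\frac{(-1)^i}{i!}\,\phi^{(i)}(\mu)\,\frac{x^{n-1-i}}{(n-1-i)!}\Bigr).$$ -/

import Mathlib

open MeasureTheory ProbabilityTheory Filter Topology
open scoped ContDiff

noncomputable section

namespace AlternatingService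

/-- The distribution function, on `[0, ∞)`, of the mixture with weights `κ 1, …, κ N` of the
Erlang-`n` distributions with common rate `μ`. -/
def mixedErlangCDF (N : ℕ) (κ : ℕ → ℝ) (μ x : ℝ) : ℝ :=
  ∑ n ∈ Finset.Icc 1 N,
    κ n * (1 - Real.exp (-(μ * x)) * ∑ j ∈ Finset.range n, (μ * x) ^ j / (j.factorial : ℝ))

/-- The alternating service system on a probability space `(Ω, P)`: service times `A n` with law
`α`, preparation times `B n` with law `β`, all independent, and server waiting times `W n`. -/
structure IsWaitingProcess {Ω : Type*} [MeasurableSpace Ω] (P : Measure Ω) (α β : Measure ℝ)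
    (A B W : ℕ → Ω → ℝ) : Prop where
  measurable_service : ∀ n, Measurable (A n)
  measurable_preparation : ∀ n, Measurable (B n)
  measurable_init : Measurable (W 0)
  law_service : ∀ n, P.map (A n) = α
  law_preparation : ∀ n, P.map (B n) = β
  /-- the two sequences are i.i.d. and mutually independent -/
  indep : iIndepFun (Sum.elim A B) P
  init_nonneg : ∀ᵐ o ∂P, 0 ≤ W 0 o
  /-- the initial waiting time is independent of the variables that drive the recursion -/
  indep_init : IndepFun (W 0) (fun o => ((fun n => A n o, fun n => B (n + 1) o) :
    (ℕ → ℝ) × (ℕ → ℝ))) P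
  recursion : ∀ n o, W (n + 1) o = max 0 (B (n + 1) o - A n o - W n o)

/-- `ν` is an equilibrium law of the waiting time: if `W, A, B` are independent with laws
`ν, α, β`, then `W` and `max 0 (B - A - W)` have the same law. -/
def IsStationaryLaw (α β ν : Measure ℝ) : Prop :=
  IsProbabilityMeasure ν ∧
    (ν.prod (α.prod β)).map (fun p : ℝ × ℝ × ℝ => max 0 (p.2.2 - p.2.1 - p.1)) = ν

/-- The Laplace transform of a law that is concentrated on `[0, ∞)`. -/
def laplace (ν : Measure ℝ) (s : ℝ) : ℝ := ∫ x, Real.exp (-(s * x)) ∂ν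

/-- The function `φ`: the product of the Laplace transforms of waiting and service times. -/
def phi (ν α : Measure ℝ) (s : ℝ) : ℝ := laplace ν s * laplace α s

/-- The claimed mass at zero, as a function of the derivatives of `φ` at `μ`. -/
def massAtZero (N : ℕ) (κ : ℕ → ℝ) (μ : ℝ) (φ : ℝ → ℝ) : ℝ :=
  1 - ∑ n ∈ Finset.Icc 1 N, ∑ i ∈ Finset.range n,
    κ n * ((-μ) ^ i / (i.factorial : ℝ)) * iteratedDeriv i φ μ

/-- The density expression for Erlang-`n` preparation times. -/
def erlangDensity (n : ℕ) (μ : ℝ) (φ : ℝ → ℝ) (x : ℝ) : ℝ :=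
  μ ^ n * Real.exp (-(μ * x)) * ∑ i ∈ Finset.range n,
    (-1) ^ i / (i.factorial : ℝ) * iteratedDeriv i φ μ *
      (x ^ (n - 1 - i) / ((n - 1 - i).factorial : ℝ))

/-- The claimed waiting time density: the `κ`-weighted sum of the Erlang expressions. -/
def waitingDensity (N : ℕ) (κ : ℕ → ℝ) (μ : ℝ) (φ : ℝ → ℝ) (x : ℝ) : ℝ :=
  ∑ n ∈ Finset.Icc 1 N, κ n * erlangDensity n μ φ x

end AlternatingService

end

/-!
Let `ξ` be the law of `B - A`. One step of the recursion sends a law `ν` to `reflect ξ ν`, the law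
of `max 0 (X - W)` with independent `X ∼ ξ`, `W ∼ ν`; this uses that `W n` is independent of the
variables that drive the recursion from time `n` on (`IsWaitingProcess.map_waiting_succ`).

*Existence, uniqueness, convergence.* In the uniform distance of distribution functions `reflect ξ`
is nonexpansive, and its square contracts laws on `[0, ∞)` by a factor below one as soon as
`P (X ≥ δ) < 1` and `P (X ≥ 2 δ) > 0` for some `δ > 0` (`CdfClose.reflect_reflect`). One step alone
need not contract: for `A = 0`, `P (X > 0) = 1`. The orbits are therefore Cauchy, the limit of the
distribution functions is a distribution function, and its law is the only fixed point
(`exists_unique_invariant`). For mixed-Erlang `B` and nonnegative `A` both conditions hold with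
`δ = 1`, since `B` has a positive density on `(0, ∞)`.

*Mass and density.* With `Y` distributed as `W + A`, an equilibrium law is the law of
`max 0 (B - Y)`. Its mass at zero is `P (B ≤ Y) = P (B < Y) = E [F (Y)]`, and on `(0, ∞)` it has the
density `u ↦ E [g (u + Y)]`, where `F` and `g` are the distribution function and density of `B`.
Expanding the powers of `u + Y` leaves the moments `E [Y ^ i e ^ (-μ Y)]`, which are
`(-1) ^ i φ^(i) (μ)` because `φ` is the Laplace transform of `Y` (`iteratedDeriv_phi`).
-/

namespace AlternatingService

/-! ### The reflection map on laws -/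

/-- The law of `max 0 (X - W)` when `W` and `X` are independent with laws `ν` and `ξ`. -/
noncomputable def reflect (ξ ν : Measure ℝ) : Measure ℝ :=
  (ν.prod ξ).map fun p : ℝ × ℝ => max 0 (p.2 - p.1)

lemma measurable_reflect_map : Measurable fun p : ℝ × ℝ => max 0 (p.2 - p.1) := by fun_prop

instance (ξ ν : Measure ℝ) [IsProbabilityMeasure ξ] [IsProbabilityMeasure ν] :
    IsProbabilityMeasure (reflect ξ ν) :=
  Measure.isProbabilityMeasure_map measurable_reflect_map.aemeasurable

lemma reflect_Iio_zero (ξ ν : Measure ℝ) : reflect ξ ν (Set.Iio 0) = 0 := by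
  rw [reflect, Measure.map_apply measurable_reflect_map measurableSet_Iio]
  convert! measure_empty (μ := ν.prod ξ)
  ext p
  simp

lemma measureReal_prod_eq_integral {E F : Type*} [MeasurableSpace E] [MeasurableSpace F]
    (ν : Measure E) (ξ : Measure F) [IsProbabilityMeasure ν]
    [IsProbabilityMeasure ξ] {s : Set (E × F)} (hs : MeasurableSet s) :
    (ν.prod ξ).real s = ∫ z, ν.real ((fun w => (w, z)) ⁻¹' s) ∂ξ := by
  simp only [measureReal_def]
  rw [Measure.prod_apply_symm hs, integral_toReal]
  · exact (measurable_measure_prodMk_right hs).aemeasurable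
  · exact ae_of_all _ fun _ => measure_lt_top _ _

/-! ### Contraction in the uniform distance of distribution functions -/

section Contraction

variable (ξ : Measure ℝ) [IsProbabilityMeasure ξ]
variable (ν ν' : Measure ℝ) [IsProbabilityMeasure ν] [IsProbabilityMeasure ν']

/-- `max 0 (X - W) ≤ x` means `¬ W < X - x`: reflection turns closed half-lines into open ones. -/
lemma reflect_real_Iic {x : ℝ} (hx : 0 ≤ x) :
    (reflect ξ ν).real (Set.Iic x) = ∫ z, (1 - ν.real (Set.Iio (z - x))) ∂ξ := by
  rw [reflect, map_measureReal_apply measurable_reflect_map measurableSet_Iic,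
    measureReal_prod_eq_integral _ _ (measurable_reflect_map measurableSet_Iic)]
  refine integral_congr_ae (ae_of_all _ fun z => ?_)
  dsimp only
  rw [← probReal_compl_eq_one_sub measurableSet_Iio]
  congr 1
  ext w
  simp [hx]
  constructor <;> intro h <;> linarith

lemma reflect_real_Iio {x : ℝ} (hx : 0 < x) :
    (reflect ξ ν).real (Set.Iio x) = ∫ z, (1 - ν.real (Set.Iic (z - x))) ∂ξ := by
  rw [reflect, map_measureReal_apply measurable_reflect_map measurableSet_Iio,
    measureReal_prod_eq_integral _ _ (measurable_reflect_map measurableSet_Iio)]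
  refine integral_congr_ae (ae_of_all _ fun z => ?_)
  dsimp only
  rw [← probReal_compl_eq_one_sub measurableSet_Iic]
  congr 1
  ext w
  simp [hx]
  constructor <;> intro h <;> linarith

lemma integrable_real_Iic_sub (x : ℝ) : Integrable (fun z => ν.real (Set.Iic (z - x))) ξ := by
  refine Integrable.of_bound (C := 1) (Monotone.measurable fun a b hab =>
    measureReal_mono (Set.Iic_subset_Iic.2 (by linarith))).aestronglyMeasurable
    (ae_of_all _ fun z => ?_)
  rw [Real.norm_eq_abs, abs_of_nonneg measureReal_nonneg]
  exact measureReal_le_one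

lemma integrable_real_Iio_sub (x : ℝ) : Integrable (fun z => ν.real (Set.Iio (z - x))) ξ := by
  refine Integrable.of_bound (C := 1) (Monotone.measurable fun a b hab =>
    measureReal_mono (Set.Iio_subset_Iio (by linarith))).aestronglyMeasurable
    (ae_of_all _ fun z => ?_)
  rw [Real.norm_eq_abs, abs_of_nonneg measureReal_nonneg]
  exact measureReal_le_one

variable {ξ ν ν'}

lemma abs_integral_one_sub_sub_le {f g b : ℝ → ℝ} (hf : Integrable f ξ) (hg : Integrable g ξ)
    (hb : Integrable b ξ) (h : ∀ z, |f z - g z| ≤ b z) :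
    |∫ z, (1 - f z) ∂ξ - ∫ z, (1 - g z) ∂ξ| ≤ ∫ z, b z ∂ξ := by
  have hf' : Integrable (fun z => 1 - f z) ξ := (integrable_const _).sub hf
  have hg' : Integrable (fun z => 1 - g z) ξ := (integrable_const _).sub hg
  rw [← integral_sub hf' hg']
  refine (norm_integral_le_integral_norm _).trans (integral_mono (hf'.sub hg').norm hb fun z => ?_)
  change |1 - f z - (1 - g z)| ≤ b z
  rw [sub_sub_sub_cancel_left, abs_sub_comm]
  exact h z

/-- The distribution functions of `ν` and `ν'`, and their left limits, differ by at most `d`. The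
reflection exchanges the two kinds of half-lines, so both are kept. -/
def CdfClose (d : ℝ) (ν ν' : Measure ℝ) : Prop :=
  ∀ x, |ν.real (Set.Iic x) - ν'.real (Set.Iic x)| ≤ d ∧
    |ν.real (Set.Iio x) - ν'.real (Set.Iio x)| ≤ d

lemma cdfClose_one (ν ν' : Measure ℝ) [IsProbabilityMeasure ν] [IsProbabilityMeasure ν'] :
    CdfClose 1 ν ν' := by
  intro x
  constructor <;>
  · rw [abs_le]
    constructor <;> linarith [measureReal_nonneg (μ := ν) (s := Set.Iic x),
      measureReal_nonneg (μ := ν') (s := Set.Iic x), measureReal_nonneg (μ := ν) (s := Set.Iio x),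
      measureReal_nonneg (μ := ν') (s := Set.Iio x), measureReal_le_one (μ := ν) (s := Set.Iic x),
      measureReal_le_one (μ := ν') (s := Set.Iic x), measureReal_le_one (μ := ν) (s := Set.Iio x),
      measureReal_le_one (μ := ν') (s := Set.Iio x)]

lemma real_Iic_eq_zero {ρ : Measure ℝ} (h : ρ (Set.Iio 0) = 0) {x : ℝ} (hx : x < 0) :
    ρ.real (Set.Iic x) = 0 := by
  rw [measureReal_def, measure_mono_null (Set.Iic_subset_Iio.2 hx) h, ENNReal.toReal_zero]

lemma real_Iio_eq_zero {ρ : Measure ℝ} (h : ρ (Set.Iio 0) = 0) {x : ℝ} (hx : x ≤ 0) :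
    ρ.real (Set.Iio x) = 0 := by
  rw [measureReal_def, measure_mono_null (Set.Iio_subset_Iio hx) h, ENNReal.toReal_zero]

/-- Closeness of the distribution functions passes to their left limits. -/
lemma CdfClose.of_left {d : ℝ} (h : ∀ x, |ν.real (Set.Iic x) - ν'.real (Set.Iic x)| ≤ d) :
    CdfClose d ν ν' := by
  have lim (ρ : Measure ℝ) [IsProbabilityMeasure ρ] (x : ℝ) :
      Tendsto (fun n : ℕ => ρ.real (Set.Iic (x - 1 / ((n : ℝ) + 1)))) atTop
        (𝓝 (ρ.real (Set.Iio x))) := by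
    have hU : ⋃ n : ℕ, Set.Iic (x - 1 / ((n : ℝ) + 1)) = Set.Iio x := by
      ext y
      simp only [Set.mem_iUnion, Set.mem_Iic, Set.mem_Iio]
      constructor
      · rintro ⟨n, hn⟩
        have : (0 : ℝ) < 1 / ((n : ℝ) + 1) := by positivity
        linarith
      · intro hy
        obtain ⟨n, hn⟩ := exists_nat_one_div_lt (sub_pos.2 hy)
        exact ⟨n, by linarith⟩
    have hm : Monotone fun n : ℕ => Set.Iic (x - 1 / ((n : ℝ) + 1)) := by
      intro a b hab
      refine Set.Iic_subset_Iic.2 (sub_le_sub_left ?_ _)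
      exact one_div_le_one_div_of_le (by positivity) (by exact_mod_cast Nat.succ_le_succ hab)
    have := tendsto_measure_iUnion_atTop (μ := ρ) hm
    rw [hU] at this
    exact (ENNReal.tendsto_toReal (measure_ne_top _ _)).comp this
  exact fun x => ⟨h x, le_of_tendsto ((lim ν x).sub (lim ν' x)).abs
    (Eventually.of_forall fun n => h _)⟩

lemma CdfClose.eq_of_forall_pos (h : ∀ ε > 0, CdfClose ε ν ν') : ν = ν' := by
  refine Measure.eq_of_cdf _ _ (StieltjesFunction.ext fun x => ?_)
  rw [cdf_eq_real, cdf_eq_real, ← sub_eq_zero, ← abs_eq_zero]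
  exact le_antisymm (le_of_forall_pos_le_add fun ε hε => by simpa using (h ε hε x).1) (abs_nonneg _)

/-- At `x`, the new distribution functions are averages over `X = z` of the old ones at `z - x`, so
a pointwise bound `b z` of the old discrepancies integrates to a bound of the new one. -/
lemma cdfClose_reflect_of_bound {d : ℝ} (hd : 0 ≤ d)
    (h₁ : ∀ x, 0 ≤ x → ∃ b : ℝ → ℝ, Integrable b ξ ∧ ∫ z, b z ∂ξ ≤ d ∧
      (∀ z, |ν.real (Set.Iic (z - x)) - ν'.real (Set.Iic (z - x))| ≤ b z) ∧
      ∀ z, |ν.real (Set.Iio (z - x)) - ν'.real (Set.Iio (z - x))| ≤ b z) :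
    CdfClose d (reflect ξ ν) (reflect ξ ν') := by
  intro x
  constructor
  · rcases lt_or_ge x 0 with hx | hx
    · simpa [real_Iic_eq_zero (reflect_Iio_zero ξ _) hx] using hd
    · obtain ⟨b, hb, hbd, -, hb2⟩ := h₁ x hx
      rw [reflect_real_Iic ξ ν hx, reflect_real_Iic ξ ν' hx]
      exact (abs_integral_one_sub_sub_le (integrable_real_Iio_sub ξ ν x)
        (integrable_real_Iio_sub ξ ν' x) hb hb2).trans hbd
  · rcases le_or_gt x 0 with hx | hx
    · simpa [real_Iio_eq_zero (reflect_Iio_zero ξ _) hx] using hd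
    · obtain ⟨b, hb, hbd, hb1, -⟩ := h₁ x hx.le
      rw [reflect_real_Iio ξ ν hx, reflect_real_Iio ξ ν' hx]
      exact (abs_integral_one_sub_sub_le (integrable_real_Iic_sub ξ ν x)
        (integrable_real_Iic_sub ξ ν' x) hb hb1).trans hbd

lemma CdfClose.nonneg {d : ℝ} {ρ ρ' : Measure ℝ} (h : CdfClose d ρ ρ') : 0 ≤ d :=
  (abs_nonneg _).trans (h 0).1

lemma CdfClose.reflect {d : ℝ} (h : CdfClose d ν ν') :
    CdfClose d (reflect ξ ν) (reflect ξ ν') :=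
  cdfClose_reflect_of_bound h.nonneg fun x _ =>
    ⟨fun _ => d, integrable_const _, by simp, fun z => (h _).1, fun z => (h _).2⟩

/-- Beyond `δ` one step of the recursion already contracts: `max 0 (X - W)` can only reach `[δ, ∞)`
if `X` does. -/
lemma CdfClose.reflect_tail {d δ : ℝ} (hδ : 0 < δ) (h : CdfClose d ν ν') (hν : ν (Set.Iio 0) = 0)
    (hν' : ν' (Set.Iio 0) = 0) {x : ℝ} (hx : δ ≤ x) :
    |(AlternatingService.reflect ξ ν).real (Set.Iic x) -
        (AlternatingService.reflect ξ ν').real (Set.Iic x)| ≤ ξ.real (Set.Ici δ) * d ∧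
      |(AlternatingService.reflect ξ ν).real (Set.Iio x) -
        (AlternatingService.reflect ξ ν').real (Set.Iio x)| ≤ ξ.real (Set.Ici δ) * d := by
  have hb : Integrable ((Set.Ici δ).indicator fun _ => d) ξ :=
    (integrable_const d).indicator measurableSet_Ici
  have hbi : ∫ z, (Set.Ici δ).indicator (fun _ => d) z ∂ξ = ξ.real (Set.Ici δ) * d := by
    rw [integral_indicator_const _ measurableSet_Ici, smul_eq_mul]
  rw [reflect_real_Iic ξ ν (hδ.le.trans hx), reflect_real_Iic ξ ν' (hδ.le.trans hx),
    reflect_real_Iio ξ ν (hδ.trans_le hx), reflect_real_Iio ξ ν' (hδ.trans_le hx), ← hbi]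
  constructor
  · refine abs_integral_one_sub_sub_le (integrable_real_Iio_sub ξ ν x)
      (integrable_real_Iio_sub ξ ν' x) hb fun z => ?_
    by_cases hz : δ ≤ z
    · simpa [Set.indicator, hz] using (h (z - x)).2
    · have : z - x ≤ 0 := by linarith
      simp [Set.indicator, hz, real_Iio_eq_zero hν this, real_Iio_eq_zero hν' this]
  · refine abs_integral_one_sub_sub_le (integrable_real_Iic_sub ξ ν x)
      (integrable_real_Iic_sub ξ ν' x) hb fun z => ?_
    by_cases hz : δ ≤ z
    · simpa [Set.indicator, hz] using (h (z - x)).1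
    · have : z - x < 0 := by linarith
      simp [Set.indicator, hz, real_Iic_eq_zero hν this, real_Iic_eq_zero hν' this]

/-- The contraction factor of two steps of the recursion, for a threshold `δ`. -/
noncomputable def contractionFactor (ξ : Measure ℝ) (δ : ℝ) : ℝ :=
  max (ξ.real (Set.Ici δ)) (1 - (1 - ξ.real (Set.Ici δ)) * ξ.real (Set.Ici (2 * δ)))

lemma contractionFactor_nonneg (ξ : Measure ℝ) (δ : ℝ) : 0 ≤ contractionFactor ξ δ :=
  measureReal_nonneg.trans (le_max_left _ _)

lemma contractionFactor_lt_one {ξ : Measure ℝ} {δ : ℝ} (h1 : ξ.real (Set.Ici δ) < 1)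
    (h2 : 0 < ξ.real (Set.Ici (2 * δ))) : contractionFactor ξ δ < 1 :=
  max_lt h1 (by nlinarith [mul_pos (sub_pos.2 h1) h2])

/-- Two steps contract uniformly. A discrepancy of the laws at `x` after the second step comes from
`X ≥ x`; the part `X ≥ x + δ` carries the factor gained beyond `δ` in the first step. For `x ≤ δ`
that part has mass at least `P (X ≥ 2 δ)`, and for `x ≥ δ` the event `X ≥ x` is itself small. -/
lemma CdfClose.reflect_reflect {d δ : ℝ} (hδ : 0 < δ) (h : CdfClose d ν ν')
    (hν : ν (Set.Iio 0) = 0) (hν' : ν' (Set.Iio 0) = 0) :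
    CdfClose (contractionFactor ξ δ * d)
      (AlternatingService.reflect ξ (AlternatingService.reflect ξ ν))
      (AlternatingService.reflect ξ (AlternatingService.reflect ξ ν')) := by
  have hd := h.nonneg
  set c := ξ.real (Set.Ici δ) with hc
  have hc1 : c ≤ 1 := measureReal_le_one
  have hc0 : 0 ≤ c := measureReal_nonneg
  have key : ∀ x, 0 ≤ x → ∃ b : ℝ → ℝ, Integrable b ξ ∧ ∫ z, b z ∂ξ ≤ contractionFactor ξ δ * d ∧
      ∀ z, (z < x → 0 ≤ b z) ∧ (x ≤ z → z < x + δ → d ≤ b z) ∧ (x + δ ≤ z → c * d ≤ b z) := by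
    intro x hx
    have i1 : Integrable ((Set.Ici x).indicator fun _ => d) ξ :=
      (integrable_const d).indicator measurableSet_Ici
    have i2 : Integrable ((Set.Ici (x + δ)).indicator fun _ => (1 - c) * d) ξ :=
      (integrable_const _).indicator measurableSet_Ici
    -- `b` equals `d` on `[x, x + δ)`, `c d` on `[x + δ, ∞)` and `0` below `x`.
    refine ⟨fun z => (Set.Ici x).indicator (fun _ => d) z -
      (Set.Ici (x + δ)).indicator (fun _ => (1 - c) * d) z, i1.sub i2, ?_, fun z => ⟨?_, ?_, ?_⟩⟩
    · rw [integral_sub i1 i2, integral_indicator_const _ measurableSet_Ici,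
        integral_indicator_const _ measurableSet_Ici, smul_eq_mul, smul_eq_mul, ← mul_assoc,
        ← sub_mul]
      refine mul_le_mul_of_nonneg_right ?_ hd
      rcases le_total x δ with hxδ | hxδ
      · refine le_trans ?_ (le_max_right _ _)
        have a1 : ξ.real (Set.Ici x) ≤ 1 := measureReal_le_one
        have a2 : ξ.real (Set.Ici (2 * δ)) ≤ ξ.real (Set.Ici (x + δ)) :=
          measureReal_mono (Set.Ici_subset_Ici.2 (by linarith))
        nlinarith [mul_le_mul_of_nonneg_left a2 (sub_nonneg.2 hc1)]
      · refine le_trans ?_ (le_max_left _ _)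
        have a1 : ξ.real (Set.Ici x) ≤ c := measureReal_mono (Set.Ici_subset_Ici.2 hxδ)
        have a2 : 0 ≤ ξ.real (Set.Ici (x + δ)) := measureReal_nonneg
        nlinarith [mul_nonneg a2 (sub_nonneg.2 hc1)]
    · intro hz
      have h1 : ¬ x ≤ z := by linarith
      have h2 : ¬ x + δ ≤ z := by linarith
      simp [Set.indicator, h1, h2]
    · intro h1 h2
      simp [Set.indicator, h1, not_le.2 h2]
    · intro h2
      have h1 : x ≤ z := by linarith
      simp [Set.indicator, h1, h2]
      linarith
  refine cdfClose_reflect_of_bound (mul_nonneg (contractionFactor_nonneg ξ δ) hd) fun x hx => ?_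
  obtain ⟨b, hb, hbd, hbz⟩ := key x hx
  have h1 := h.reflect (ξ := ξ)
  refine ⟨b, hb, hbd, fun z => ?_, fun z => ?_⟩
  · rcases lt_or_ge z x with hz | hz
    · simpa [real_Iic_eq_zero (reflect_Iio_zero ξ _) (sub_neg.2 hz)] using (hbz z).1 hz
    rcases lt_or_ge z (x + δ) with hz' | hz'
    · exact (h1 _).1.trans ((hbz z).2.1 hz hz')
    · exact (h.reflect_tail hδ hν hν' (by linarith)).1.trans ((hbz z).2.2 hz')
  · rcases lt_or_ge z x with hz | hz
    · simpa [real_Iio_eq_zero (reflect_Iio_zero ξ _) (sub_neg.2 hz).le] using (hbz z).1 hz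
    rcases lt_or_ge z (x + δ) with hz' | hz'
    · exact (h1 _).2.trans ((hbz z).2.1 hz hz')
    · exact (h.reflect_tail hδ hν hν' (by linarith)).2.trans ((hbz z).2.2 hz')

end Contraction

/-! ### The invariant law of the reflection -/

section Limit

variable {ξ : Measure ℝ} [IsProbabilityMeasure ξ]

/-- Two orbits of the recursion of laws approach each other geometrically. -/
lemma cdfClose_orbits {δ : ℝ} (hδ : 0 < δ) {p q : ℕ → Measure ℝ}
    [∀ n, IsProbabilityMeasure (p n)] [∀ n, IsProbabilityMeasure (q n)]
    (hp0 : ∀ n, p n (Set.Iio 0) = 0) (hq0 : ∀ n, q n (Set.Iio 0) = 0)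
    (hp : ∀ n, p (n + 1) = reflect ξ (p n)) (hq : ∀ n, q (n + 1) = reflect ξ (q n)) (n : ℕ) :
    CdfClose (contractionFactor ξ δ ^ (n / 2)) (p n) (q n) := by
  induction n using Nat.strong_induction_on with
  | _ n ih =>
    match n, ih with
    | 0, _ => simpa using cdfClose_one (p 0) (q 0)
    | 1, _ => simpa using cdfClose_one (p 1) (q 1)
    | n + 2, ih =>
      have e : (n + 2) / 2 = n / 2 + 1 := by omega
      rw [e, pow_succ', hp, hp, hq, hq]
      exact (ih n (by omega)).reflect_reflect hδ (hp0 n) (hq0 n)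

lemma tendsto_pow_half {γ : ℝ} (h0 : 0 ≤ γ) (h1 : γ < 1) :
    Tendsto (fun n : ℕ => γ ^ (n / 2)) atTop (𝓝 0) :=
  (tendsto_pow_atTop_nhds_zero_of_lt_one h0 h1).comp (Nat.tendsto_div_const_atTop (by norm_num))

/-- A sequence of laws whose distribution functions are uniformly Cauchy has a limit law. -/
lemma exists_limit_of_cdfClose {p : ℕ → Measure ℝ} [∀ n, IsProbabilityMeasure (p n)] {e : ℕ → ℝ}
    (he : Tendsto e atTop (𝓝 0)) (h : ∀ n m, CdfClose (e n) (p n) (p (n + m))) :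
    ∃ ν : Measure ℝ, IsProbabilityMeasure ν ∧ ∀ n, CdfClose (e n) (p n) ν := by
  have hC : ∀ x, CauchySeq fun n => (p n).real (Set.Iic x) := by
    intro x
    refine cauchySeq_of_le_tendsto_0' e (fun n m hnm => ?_) he
    obtain ⟨k, rfl⟩ := Nat.exists_eq_add_of_le hnm
    exact (h n k x).1
  choose F hF using fun x => cauchySeq_tendsto_of_complete (hC x)
  have hlim : ∀ n x, |(p n).real (Set.Iic x) - F x| ≤ e n := by
    intro n x
    refine le_of_tendsto ((((hF x).comp (tendsto_add_atTop_nat n)).const_sub _).abs)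
      (Eventually.of_forall fun k => ?_)
    simpa [add_comm] using (h n k x).1
  have hU : TendstoUniformly (fun n x => (p n).real (Set.Iic x)) F atTop := by
    rw [Metric.tendstoUniformly_iff]
    intro ε hε
    filter_upwards [he.eventually (gt_mem_nhds hε)] with n hn x
    rw [dist_comm]
    exact (hlim n x).trans_lt hn
  have hcdf : ∀ n x, (p n).real (Set.Iic x) = cdf (p n) x := fun n x => (cdf_eq_real _ _).symm
  have hmono : Monotone F := fun a b hab => le_of_tendsto_of_tendsto' (hF a) (hF b) fun n =>
    measureReal_mono (Set.Iic_subset_Iic.2 hab)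
  have hrc : ∀ x, ContinuousWithinAt F (Set.Ici x) x := by
    intro x
    refine (hU.tendstoUniformlyOnFilter.mono_right le_top).tendsto_of_eventually_tendsto
      (L := fun n => (p n).real (Set.Iic x)) (Eventually.of_forall fun n => ?_) (hF x)
    simp only [hcdf]
    exact (cdf (p n)).right_continuous x
  have hbot : Tendsto F atBot (𝓝 0) := by
    refine (hU.tendstoUniformlyOnFilter.mono_right le_top).tendsto_of_eventually_tendsto
      (L := fun _ => 0) (Eventually.of_forall fun n => ?_) tendsto_const_nhds
    simp only [hcdf]
    exact tendsto_cdf_atBot _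
  have htop : Tendsto F atTop (𝓝 1) := by
    refine (hU.tendstoUniformlyOnFilter.mono_right le_top).tendsto_of_eventually_tendsto
      (L := fun _ => 1) (Eventually.of_forall fun n => ?_) tendsto_const_nhds
    simp only [hcdf]
    exact tendsto_cdf_atTop _
  let G : StieltjesFunction ℝ := ⟨F, hmono, hrc⟩
  have hprob : IsProbabilityMeasure G.measure :=
    ⟨by rw [G.measure_univ hbot htop, sub_zero, ENNReal.ofReal_one]⟩
  refine ⟨G.measure, hprob, fun n => CdfClose.of_left fun x => ?_⟩
  rw [← cdf_eq_real G.measure, cdf_measure_stieltjesFunction G hbot htop]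
  exact hlim n x

/-- The recursion `W' = max 0 (X - W)` has a unique invariant law, and the distribution functions
of every nonnegative orbit converge to it. -/
theorem exists_unique_invariant {δ : ℝ} (hδ : 0 < δ) (h1 : ξ.real (Set.Ici δ) < 1)
    (h2 : 0 < ξ.real (Set.Ici (2 * δ))) :
    ∃ ν : Measure ℝ, IsProbabilityMeasure ν ∧ reflect ξ ν = ν ∧
      (∀ ν' : Measure ℝ, IsProbabilityMeasure ν' → reflect ξ ν' = ν' → ν' = ν) ∧
      ∀ p : ℕ → Measure ℝ, (∀ n, IsProbabilityMeasure (p n)) → p 0 (Set.Iio 0) = 0 →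
        (∀ n, p (n + 1) = reflect ξ (p n)) →
        ∀ x, Tendsto (fun n => (p n).real (Set.Iic x)) atTop (𝓝 (ν.real (Set.Iic x))) := by
  have he := tendsto_pow_half (contractionFactor_nonneg ξ δ) (contractionFactor_lt_one h1 h2)
  have hnn : ∀ p : ℕ → Measure ℝ, p 0 (Set.Iio 0) = 0 → (∀ n, p (n + 1) = reflect ξ (p n)) →
      ∀ n, p n (Set.Iio 0) = 0 := by
    intro p h0 hp n
    cases n with
    | zero => exact h0
    | succ n => rw [hp]; exact reflect_Iio_zero _ _
  -- Any nonnegative starting law gives the invariant law; the orbit of `δ₀` is used.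
  let p : ℕ → Measure ℝ := fun n => (reflect ξ)^[n] (Measure.dirac 0)
  have hp : ∀ n, p (n + 1) = reflect ξ (p n) := fun n => Function.iterate_succ_apply' _ _ _
  have hpp : ∀ n, IsProbabilityMeasure (p n) := by
    intro n
    induction n with
    | zero => exact inferInstanceAs (IsProbabilityMeasure (Measure.dirac (0 : ℝ)))
    | succ n ih => rw [hp]; infer_instance
  have hp0 := hnn p (by simp [p]) hp
  -- The orbit is Cauchy because its shifts are orbits too.
  obtain ⟨ν, hν, hclose⟩ := exists_limit_of_cdfClose he fun n m =>
    cdfClose_orbits (p := p) (q := fun n => p (n + m)) hδ hp0 (fun n => hp0 _) hp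
      (fun n => by rw [← hp]; congr 1; omega) n
  have hfix : reflect ξ ν = ν := by
    refine CdfClose.eq_of_forall_pos fun ε hε => ?_
    obtain ⟨n, hn⟩ := ((he.eventually (gt_mem_nhds (half_pos hε))).and
      ((he.comp (tendsto_add_atTop_nat 1)).eventually (gt_mem_nhds (half_pos hε)))).exists
    have a := (hclose n).reflect (ξ := ξ)
    rw [← hp] at a
    refine CdfClose.of_left fun x => ?_
    have a1 := abs_le.1 (a x).1
    have a2 := abs_le.1 (hclose (n + 1) x).1
    have := hn.1
    have := hn.2
    simp only [Function.comp] at this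
    rw [abs_le]
    constructor <;> linarith
  have hν0 : ν (Set.Iio 0) = 0 := hfix ▸ reflect_Iio_zero ξ ν
  refine ⟨ν, hν, hfix, fun ν' hν' hfix' => ?_, fun q hq hq0 hqr x => ?_⟩
  · have hν0' : ν' (Set.Iio 0) = 0 := hfix' ▸ reflect_Iio_zero ξ ν'
    refine CdfClose.eq_of_forall_pos fun ε hε => ?_
    obtain ⟨n, hn⟩ := (he.eventually (gt_mem_nhds hε)).exists
    have := cdfClose_orbits (ξ := ξ) (p := fun _ => ν') (q := fun _ => ν) hδ (fun _ => hν0')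
      (fun _ => hν0) (fun _ => hfix'.symm) (fun _ => hfix.symm) n
    exact CdfClose.of_left fun x => (this x).1.trans hn.le
  · have hc := cdfClose_orbits (ξ := ξ) (p := q) (q := fun _ => ν) hδ (hnn q hq0 hqr) (fun _ => hν0)
      hqr (fun _ => hfix.symm)
    exact tendsto_iff_norm_sub_tendsto_zero.2
      (squeeze_zero (fun _ => norm_nonneg _) (fun n => (hc n x).1) he)

end Limit

/-! ### The mixed-Erlang law -/

/-- The density on `(0, ∞)` of the mixture with weights `κ 1, …, κ N` of the Erlang-`n`
distributions with common rate `μ`. -/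
noncomputable def mixedErlangPDF (N : ℕ) (κ : ℕ → ℝ) (μ x : ℝ) : ℝ :=
  ∑ n ∈ Finset.Icc 1 N,
    κ n * (μ ^ n * Real.exp (-(μ * x)) * (x ^ (n - 1) / ((n - 1).factorial : ℝ)))

lemma continuous_mixedErlangPDF (N : ℕ) (κ : ℕ → ℝ) (μ : ℝ) :
    Continuous (mixedErlangPDF N κ μ) := by
  unfold mixedErlangPDF
  fun_prop

lemma mixedErlangPDF_nonneg {N : ℕ} {κ : ℕ → ℝ} {μ : ℝ} (hμ : 0 < μ)
    (hκ : ∀ n ∈ Finset.Icc 1 N, 0 ≤ κ n) {x : ℝ} (hx : 0 ≤ x) : 0 ≤ mixedErlangPDF N κ μ x :=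
  Finset.sum_nonneg fun n hn => mul_nonneg (hκ n hn) (by positivity)

lemma mixedErlangPDF_pos {N : ℕ} {κ : ℕ → ℝ} {μ : ℝ} (hμ : 0 < μ)
    (hκ : ∀ n ∈ Finset.Icc 1 N, 0 ≤ κ n) (hκ_sum : ∑ n ∈ Finset.Icc 1 N, κ n = 1) {x : ℝ}
    (hx : 0 < x) : 0 < mixedErlangPDF N κ μ x := by
  obtain ⟨n, hn, hn0⟩ := Finset.exists_ne_zero_of_sum_ne_zero (hκ_sum.trans_ne one_ne_zero)
  exact Finset.sum_pos' (fun n hn => mul_nonneg (hκ n hn) (by positivity))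
    ⟨n, hn, mul_pos (lt_of_le_of_ne (hκ n hn) hn0.symm) (by positivity)⟩

/-- The derivative of the Erlang-`(m + 1)` tail is minus the Erlang-`(m + 1)` density: the sum over
`j` telescopes. -/
lemma hasDerivAt_exp_mul_sum (μ x : ℝ) (m : ℕ) :
    HasDerivAt (fun x : ℝ => Real.exp (-(μ * x)) *
        ∑ j ∈ Finset.range (m + 1), (μ * x) ^ j / (j.factorial : ℝ))
      (-(μ ^ (m + 1) * Real.exp (-(μ * x)) * (x ^ m / (m.factorial : ℝ)))) x := by
  have hlin : HasDerivAt (fun x : ℝ => μ * x) μ x := by simpa using (hasDerivAt_id x).const_mul μ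
  have hexp : HasDerivAt (fun x : ℝ => Real.exp (-(μ * x))) (Real.exp (-(μ * x)) * -μ) x :=
    hlin.neg.exp
  induction m with
  | zero =>
    simp only [zero_add, Finset.sum_range_one, pow_zero, Nat.factorial_zero, Nat.cast_one, div_one,
      mul_one, pow_one]
    convert! hexp using 1
    ring
  | succ m ih =>
    have h := ih.add (hexp.mul ((hlin.pow (m + 1)).div_const ((m + 1).factorial : ℝ)))
    convert! h using 1
    · ext y
      simp [Finset.sum_range_succ _ (m + 1), mul_add]
    · have : ((m + 1).factorial : ℝ) = (m + 1) * m.factorial := by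
        push_cast [Nat.factorial_succ]; ring
      have h0 : (m.factorial : ℝ) ≠ 0 := by positivity
      have h1 : (m : ℝ) + 1 ≠ 0 := by positivity
      rw [this]
      simp only [Nat.add_sub_cancel, Nat.cast_add, Nat.cast_one, Pi.pow_apply]
      field_simp
      ring

lemma hasDerivAt_mixedErlangCDF (N : ℕ) (κ : ℕ → ℝ) (μ x : ℝ) :
    HasDerivAt (mixedErlangCDF N κ μ) (mixedErlangPDF N κ μ x) x := by
  unfold mixedErlangCDF mixedErlangPDF
  refine HasDerivAt.fun_sum fun n hn => HasDerivAt.const_mul _ ?_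
  obtain ⟨m, rfl⟩ := Nat.exists_eq_add_of_le' (Finset.mem_Icc.1 hn).1
  simpa using (hasDerivAt_exp_mul_sum μ x m).const_sub 1

lemma mixedErlangCDF_zero (N : ℕ) (κ : ℕ → ℝ) (μ : ℝ) : mixedErlangCDF N κ μ 0 = 0 := by
  refine Finset.sum_eq_zero fun n hn => ?_
  obtain ⟨m, rfl⟩ := Nat.exists_eq_add_of_le' (Finset.mem_Icc.1 hn).1
  simp [Finset.sum_range_succ']

/-- The law `β` with the mixed-Erlang distribution function has the mixed-Erlang density. -/
lemma eq_withDensity_of_cdf {β : Measure ℝ} [IsProbabilityMeasure β] {N : ℕ} {κ : ℕ → ℝ} {μ : ℝ}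
    (hμ : 0 < μ) (hκ : ∀ n ∈ Finset.Icc 1 N, 0 ≤ κ n)
    (hβ : ∀ x : ℝ, 0 ≤ x → cdf β x = mixedErlangCDF N κ μ x) :
    β = (volume.restrict (Set.Ioi 0)).withDensity
      fun x => ENNReal.ofReal (mixedErlangPDF N κ μ x) := by
  refine Measure.ext_of_Iic _ _ fun a => ?_
  rw [withDensity_apply _ measurableSet_Iic, Measure.restrict_restrict measurableSet_Iic]
  rcases lt_or_ge a 0 with ha | ha
  · have h0 : β (Set.Iic 0) = 0 := by
      rw [← ofReal_cdf, hβ 0 le_rfl, mixedErlangCDF_zero, ENNReal.ofReal_zero]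
    have he : Set.Iic a ∩ Set.Ioi 0 = ∅ := by
      rw [Set.inter_comm, Set.Ioi_inter_Iic, Set.Ioc_eq_empty (not_lt.2 ha.le)]
    rw [measure_mono_null (Set.Iic_subset_Iic.2 ha.le) h0, he, Measure.restrict_empty,
      lintegral_zero_measure]
  · have hc := continuous_mixedErlangPDF N κ μ
    rw [Set.inter_comm, Set.Ioi_inter_Iic, ← ofReal_integral_eq_lintegral_ofReal
      (hc.integrableOn_Ioc) ((ae_restrict_mem measurableSet_Ioc).mono
        fun x hx => mixedErlangPDF_nonneg hμ hκ hx.1.le),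
      ← intervalIntegral.integral_of_le ha, intervalIntegral.integral_eq_sub_of_hasDerivAt
        (fun x _ => hasDerivAt_mixedErlangCDF N κ μ x) (hc.intervalIntegrable _ _),
      mixedErlangCDF_zero, sub_zero, ← hβ a ha, ofReal_cdf]

/-- The mixed-Erlang law charges every set of positive Lebesgue measure in `(0, ∞)`. -/
lemma restrict_absolutelyContinuous_of_cdf {β : Measure ℝ} [IsProbabilityMeasure β] {N : ℕ}
    {κ : ℕ → ℝ} {μ : ℝ} (hμ : 0 < μ) (hκ : ∀ n ∈ Finset.Icc 1 N, 0 ≤ κ n)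
    (hκ_sum : ∑ n ∈ Finset.Icc 1 N, κ n = 1)
    (hβ : ∀ x : ℝ, 0 ≤ x → cdf β x = mixedErlangCDF N κ μ x) :
    volume.restrict (Set.Ioi 0) ≪ β := by
  rw [eq_withDensity_of_cdf hμ hκ hβ]
  refine withDensity_absolutelyContinuous' (by
    have := (continuous_mixedErlangPDF N κ μ).measurable; fun_prop) ?_
  filter_upwards [ae_restrict_mem measurableSet_Ioi] with x hx
  exact (ENNReal.ofReal_pos.2 (mixedErlangPDF_pos hμ hκ hκ_sum hx)).ne'

/-! ### The law of the gap `B - A` -/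

/-- The law of the difference `B - A` of independent `A` and `B` with laws `α` and `β`. -/
noncomputable def gapLaw (α β : Measure ℝ) : Measure ℝ :=
  (α.prod β).map fun q : ℝ × ℝ => q.2 - q.1

lemma measurable_gap : Measurable fun q : ℝ × ℝ => q.2 - q.1 := by fun_prop

instance (α β : Measure ℝ) [IsProbabilityMeasure α] [IsProbabilityMeasure β] :
    IsProbabilityMeasure (gapLaw α β) :=
  Measure.isProbabilityMeasure_map measurable_gap.aemeasurable

lemma map_prod_eq_reflect (α β ν : Measure ℝ) [IsProbabilityMeasure α] [IsProbabilityMeasure β]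
    [IsProbabilityMeasure ν] :
    (ν.prod (α.prod β)).map (fun p : ℝ × ℝ × ℝ => max 0 (p.2.2 - p.2.1 - p.1)) =
      reflect (gapLaw α β) ν := by
  have h := Measure.map_prod_map ν (α.prod β) measurable_id measurable_gap
  rw [Measure.map_id] at h
  rw [reflect, gapLaw, h, Measure.map_map measurable_reflect_map (by fun_prop)]
  rfl

/-- `B - A < 1` with positive probability, since `B` charges `(0, 1)` and `A ≥ 0`. -/
lemma gapLaw_Ici_one_lt {α β : Measure ℝ} [IsProbabilityMeasure α] [IsProbabilityMeasure β]
    (hα : ∀ᵐ a ∂α, 0 ≤ a) (hβ : volume.restrict (Set.Ioi 0) ≪ β) :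
    (gapLaw α β).real (Set.Ici 1) < 1 := by
  have hpos : β (Set.Iio 1) ≠ 0 := fun h => by
    have := hβ h
    rw [Measure.restrict_apply measurableSet_Iio, Set.Iio_inter_Ioi, Real.volume_Ioo] at this
    simp at this
  have hα0 : α (Set.Iio 0) = 0 := by
    rw [measure_eq_zero_iff_ae_notMem]
    filter_upwards [hα] with a ha
    simpa using ha
  have hle : (gapLaw α β).real (Set.Ici 1) ≤ β.real (Set.Ici 1) := by
    refine ENNReal.toReal_mono (measure_ne_top _ _) ?_
    rw [gapLaw, Measure.map_apply measurable_gap measurableSet_Ici]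
    calc (α.prod β) ((fun q : ℝ × ℝ => q.2 - q.1) ⁻¹' Set.Ici 1)
        ≤ (α.prod β) (Set.Iio 0 ×ˢ Set.univ ∪ Set.univ ×ˢ Set.Ici 1) := by
          refine measure_mono fun q hq => ?_
          simp only [Set.mem_preimage, Set.mem_Ici] at hq
          rcases lt_or_ge q.1 0 with h | h
          · exact Or.inl ⟨h, trivial⟩
          · exact Or.inr ⟨trivial, show (1 : ℝ) ≤ q.2 by linarith⟩
      _ ≤ _ := measure_union_le _ _
      _ = β (Set.Ici 1) := by simp [Measure.prod_prod, hα0]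
  refine hle.trans_lt ?_
  rw [← Set.compl_Iio, probReal_compl_eq_one_sub measurableSet_Iio]
  have : 0 < β.real (Set.Iio 1) := ENNReal.toReal_pos hpos (measure_ne_top _ _)
  linarith

/-- `B - A` is unbounded above, since `B` is. -/
lemma gapLaw_Ici_pos {α β : Measure ℝ} [IsProbabilityMeasure α] [IsProbabilityMeasure β]
    (hβ : volume.restrict (Set.Ioi 0) ≪ β) (t : ℝ) : 0 < (gapLaw α β).real (Set.Ici t) := by
  obtain ⟨M, hM⟩ : ∃ M : ℕ, α (Set.Iic (M : ℝ)) ≠ 0 := by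
    by_contra! h
    have hU : ⋃ M : ℕ, Set.Iic (M : ℝ) = Set.univ := by
      ext y
      simpa using exists_nat_ge y
    have := measure_iUnion_null h
    rw [hU, measure_univ] at this
    exact one_ne_zero this
  have hB : β (Set.Ici (t + M)) ≠ 0 := fun h => by
    have := hβ h
    rw [Measure.restrict_apply measurableSet_Ici] at this
    have h2 := measure_mono_null (show Set.Ioi (max (t + M) 0) ⊆ Set.Ici (t + M) ∩ Set.Ioi 0 from
      fun x hx => by
        have := max_lt_iff.1 (Set.mem_Ioi.1 hx)
        exact ⟨this.1.le, this.2⟩) this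
    simp at h2
  refine ENNReal.toReal_pos (fun h => ?_) (measure_ne_top _ _)
  rw [gapLaw, Measure.map_apply measurable_gap measurableSet_Ici] at h
  have h2 := measure_mono_null (show Set.Iic (M : ℝ) ×ˢ Set.Ici (t + M) ⊆
    (fun q : ℝ × ℝ => q.2 - q.1) ⁻¹' Set.Ici t from fun q hq => by
      have h1 : q.1 ≤ M := hq.1
      have h2 : t + M ≤ q.2 := hq.2
      show t ≤ q.2 - q.1
      linarith) h
  rw [Measure.prod_prod, mul_eq_zero] at h2
  exact h2.elim hM hB

/-! ### The laws of the waiting times -/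

lemma IndepFun.prodMk_left_of_prodMk_right {Ω E F G : Type*} [MeasurableSpace Ω]
    [MeasurableSpace E] [MeasurableSpace F] [MeasurableSpace G] {P : Measure Ω}
    [IsProbabilityMeasure P] {X : Ω → E} {Y : Ω → F} {Z : Ω → G} (hX : Measurable X)
    (hY : Measurable Y) (hZ : Measurable Z) (h : IndepFun X (fun o => (Y o, Z o)) P)
    (hYZ : IndepFun Y Z P) : IndepFun (fun o => (X o, Y o)) Z P := by
  have := Measure.isProbabilityMeasure_map (μ := P) hX.aemeasurable
  have := Measure.isProbabilityMeasure_map (μ := P) hY.aemeasurable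
  have := Measure.isProbabilityMeasure_map (μ := P) hZ.aemeasurable
  have hXY : IndepFun X Y P := h.comp measurable_id measurable_fst
  rw [indepFun_iff_map_prod_eq_prod_map_map (by fun_prop) (by fun_prop)] at h hYZ hXY ⊢
  rw [hXY]
  rw [hYZ, ← Measure.prodAssoc_prod] at h
  apply (MeasurableEquiv.prodAssoc (α := E) (β := F) (γ := G)).measurableEmbedding.map_injective
  rw [← h, Measure.map_map (MeasurableEquiv.measurable _) (by fun_prop)]
  rfl

namespace IsWaitingProcess

variable {Ω : Type*} [MeasurableSpace Ω] {P : Measure Ω} {α β : Measure ℝ} {A B W : ℕ → Ω → ℝ}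

lemma measurable_waiting (h : IsWaitingProcess P α β A B W) (n : ℕ) : Measurable (W n) := by
  induction n with
  | zero => exact h.measurable_init
  | succ n ih =>
    have e : W (n + 1) = fun o => max 0 (B (n + 1) o - A n o - W n o) := funext (h.recursion n)
    have hA := h.measurable_service n
    have hB := h.measurable_preparation (n + 1)
    rw [e]
    fun_prop

/-- The variables that drive the recursion from time `n` on. -/
def future (A B : ℕ → Ω → ℝ) (n : ℕ) (o : Ω) : (ℕ → ℝ) × (ℕ → ℝ) :=
  (fun k => A (n + k) o, fun k => B (n + k + 1) o)

lemma measurable_future (h : IsWaitingProcess P α β A B W) (n : ℕ) :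
    Measurable (future A B n) :=
  (measurable_pi_lambda _ fun _ => h.measurable_service _).prodMk
    (measurable_pi_lambda _ fun _ => h.measurable_preparation _)

lemma indepFun_now_future (h : IsWaitingProcess P α β A B W) (n : ℕ) :
    IndepFun (fun o => (A n o, B (n + 1) o)) (future A B (n + 1)) P := by
  let now : Set (ℕ ⊕ ℕ) := {Sum.inl n, Sum.inr (n + 1)}
  let m : ℕ ⊕ ℕ → MeasurableSpace Ω :=
    fun i => MeasurableSpace.comap (Sum.elim A B i) inferInstance
  have hm : ∀ i, m i ≤ ‹MeasurableSpace Ω› := by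
    rintro (k | k)
    · exact (h.measurable_service k).comap_le
    · exact (h.measurable_preparation k).comap_le
  have key := indep_iSup_of_disjoint hm h.indep.iIndep (disjoint_compl_right (a := now))
  have meas (S : Set (ℕ ⊕ ℕ)) (i : ℕ ⊕ ℕ) (hi : i ∈ S) :
      Measurable[⨆ j ∈ S, m j] (Sum.elim A B i) :=
    (comap_measurable _).mono (le_iSup₂_of_le i hi le_rfl) le_rfl
  rw [IndepFun_iff_Indep]
  refine indep_of_indep_of_le_left (indep_of_indep_of_le_right key ?_) ?_
  · rw [← measurable_iff_comap_le]
    refine Measurable.prodMk (@measurable_pi_lambda Ω ℕ _ (⨆ i ∈ nowᶜ, m i) _ _ fun k => ?_)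
      (@measurable_pi_lambda Ω ℕ _ (⨆ i ∈ nowᶜ, m i) _ _ fun k => ?_)
    · exact meas nowᶜ (Sum.inl (n + 1 + k)) (by simp [now]; omega)
    · exact meas nowᶜ (Sum.inr (n + 1 + k + 1)) (by simp [now]; omega)
  · rw [← measurable_iff_comap_le]
    exact Measurable.prodMk (meas now (Sum.inl n) (by simp [now]))
      (meas now (Sum.inr (n + 1)) (by simp [now]))

/-- The waiting time at time `n` is independent of the variables that drive the recursion from time
`n` on. -/
lemma indepFun_future (h : IsWaitingProcess P α β A B W) [IsProbabilityMeasure P] (n : ℕ) :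
    IndepFun (W n) (future A B n) P := by
  induction n with
  | zero =>
    convert! h.indep_init using 1
    ext o : 1
    simp [future]
  | succ n ih =>
    have hA := h.measurable_service n
    have hB := h.measurable_preparation (n + 1)
    have hsplit : IndepFun (W n) (fun o => ((A n o, B (n + 1) o), future A B (n + 1) o)) P := by
      have := ih.comp measurable_id (show Measurable fun q : (ℕ → ℝ) × (ℕ → ℝ) =>
        ((q.1 0, q.2 0), ((fun k => q.1 (k + 1)), fun k => q.2 (k + 1))) by fun_prop)
      convert! this using 1
      ext o : 1
      simp [future, add_assoc, add_comm, add_left_comm]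
    have h2 := IndepFun.prodMk_left_of_prodMk_right (h.measurable_waiting n)
      (by fun_prop) (h.measurable_future (n + 1)) hsplit (h.indepFun_now_future n)
    have h3 := h2.comp (show Measurable fun p : ℝ × ℝ × ℝ => max 0 (p.2.2 - p.2.1 - p.1) by
      fun_prop) measurable_id
    convert! h3 using 1
    exact funext (h.recursion n)

/-- One step of the recursion acts on laws as the reflection at the law of `B - A`. -/
lemma map_waiting_succ (h : IsWaitingProcess P α β A B W) [IsProbabilityMeasure P]
    [IsProbabilityMeasure α] [IsProbabilityMeasure β] (n : ℕ) :
    P.map (W (n + 1)) = reflect (gapLaw α β) (P.map (W n)) := by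
  have hA := h.measurable_service n
  have hB := h.measurable_preparation (n + 1)
  have hW := h.measurable_waiting n
  have := Measure.isProbabilityMeasure_map (μ := P) hW.aemeasurable
  have hAB : IndepFun (A n) (B (n + 1)) P :=
    h.indep.indepFun (i := Sum.inl n) (j := Sum.inr (n + 1)) (by simp)
  have hWAB : IndepFun (W n) (fun o => (A n o, B (n + 1) o)) P :=
    (h.indepFun_future n).comp measurable_id
      (show Measurable fun q : (ℕ → ℝ) × (ℕ → ℝ) => (q.1 0, q.2 0) by fun_prop)
  rw [indepFun_iff_map_prod_eq_prod_map_map (by fun_prop) (by fun_prop)] at hAB hWAB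
  rw [hAB, h.law_service, h.law_preparation] at hWAB
  rw [← map_prod_eq_reflect, ← hWAB, Measure.map_map (by fun_prop) (by fun_prop)]
  congr 1
  exact funext (h.recursion n)

end IsWaitingProcess

/-! ### Exponential moments of `W + A` -/

/-- The law of the sum `W + A` of independent `W` and `A` with laws `ν` and `α`. -/
noncomputable def sumLaw (ν α : Measure ℝ) : Measure ℝ :=
  (ν.prod α).map fun q : ℝ × ℝ => q.1 + q.2

instance (ν α : Measure ℝ) [IsProbabilityMeasure ν] [IsProbabilityMeasure α] :
    IsProbabilityMeasure (sumLaw ν α) :=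
  Measure.isProbabilityMeasure_map (by fun_prop)

lemma ae_nonneg_sumLaw {ν α : Measure ℝ} [IsProbabilityMeasure ν] [IsProbabilityMeasure α]
    (hν : ∀ᵐ w ∂ν, 0 ≤ w) (hα : ∀ᵐ a ∂α, 0 ≤ a) : ∀ᵐ y ∂sumLaw ν α, 0 ≤ y := by
  rw [sumLaw, ae_map_iff (by fun_prop) measurableSet_Ici]
  filter_upwards [Measure.quasiMeasurePreserving_fst.ae hν,
    Measure.quasiMeasurePreserving_snd.ae hα] with q h1 h2
  exact add_nonneg h1 h2

lemma phi_eq_mgf (ν α : Measure ℝ) [IsProbabilityMeasure ν] [IsProbabilityMeasure α] :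
    phi ν α = fun s => mgf id (sumLaw ν α) (-s) := by
  ext s
  rw [phi, laplace, laplace, ← integral_prod_mul, mgf, sumLaw,
    integral_map (by fun_prop) (by fun_prop)]
  refine integral_congr_ae (ae_of_all _ fun q => ?_)
  simp only [id, ← Real.exp_add]
  congr 1
  ring

section Moments

variable {η : Measure ℝ} [IsProbabilityMeasure η]

lemma neg_mem_interior_integrableExpSet (hη : ∀ᵐ y ∂η, 0 ≤ y) {μ : ℝ} (hμ : 0 < μ) :
    -μ ∈ interior (integrableExpSet id η) := by
  refine mem_interior.2 ⟨Set.Iio 0, fun t ht => ?_, isOpen_Iio, neg_lt_zero.2 hμ⟩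
  refine Integrable.of_bound (C := 1) (by fun_prop) ?_
  filter_upwards [hη] with y hy
  rw [Real.norm_eq_abs, Real.abs_exp, Real.exp_le_one_iff]
  exact mul_nonpos_of_nonpos_of_nonneg (le_of_lt ht) hy

lemma integrable_pow_mul_exp (hη : ∀ᵐ y ∂η, 0 ≤ y) {μ : ℝ} (hμ : 0 < μ) (i : ℕ) :
    Integrable (fun y => y ^ i * Real.exp (-(μ * y))) η := by
  simpa using integrable_pow_mul_exp_of_mem_interior_integrableExpSet
    (neg_mem_interior_integrableExpSet hη hμ) i

end Moments

lemma contDiffAt_phi {ν α : Measure ℝ} [IsProbabilityMeasure ν] [IsProbabilityMeasure α]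
    (h : ∀ᵐ y ∂sumLaw ν α, 0 ≤ y) {μ : ℝ} (hμ : 0 < μ) : ContDiffAt ℝ ∞ (phi ν α) μ := by
  rw [phi_eq_mgf]
  have hmgf : ContDiffAt ℝ ∞ (mgf id (sumLaw ν α)) (-μ) :=
    (analyticAt_mgf (neg_mem_interior_integrableExpSet h hμ)).contDiffAt
  exact hmgf.comp μ (f := fun s : ℝ => -s) contDiffAt_id.neg

/-- `φ` is the Laplace transform of `Y = W + A`, so `φ^(i) (μ) = (-1) ^ i E [Y ^ i e ^ (-μ Y)]`. -/
lemma iteratedDeriv_phi {ν α : Measure ℝ} [IsProbabilityMeasure ν] [IsProbabilityMeasure α]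
    (h : ∀ᵐ y ∂sumLaw ν α, 0 ≤ y) {μ : ℝ} (hμ : 0 < μ) (i : ℕ) :
    iteratedDeriv i (phi ν α) μ =
      (-1) ^ i * ∫ y, y ^ i * Real.exp (-(μ * y)) ∂sumLaw ν α := by
  rw [phi_eq_mgf, iteratedDeriv_comp_neg,
    iteratedDeriv_mgf (neg_mem_interior_integrableExpSet h hμ), smul_eq_mul]
  simp

lemma neg_one_pow_mul_self (i : ℕ) (x : ℝ) : (-1) ^ i * ((-1) ^ i * x) = x := by
  rw [← mul_assoc, ← mul_pow]
  simp

/-! ### Mass at zero and density -/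

lemma add_pow_div_factorial (u y : ℝ) (m : ℕ) :
    (u + y) ^ m / (m.factorial : ℝ) = ∑ i ∈ Finset.range (m + 1),
      1 / (i.factorial : ℝ) * (u ^ (m - i) / ((m - i).factorial : ℝ)) * y ^ i := by
  rw [add_comm, add_pow, Finset.sum_div]
  refine Finset.sum_congr rfl fun i hi => ?_
  rw [Nat.cast_choose ℝ (Finset.mem_range_succ_iff.1 hi)]
  have : (m.factorial : ℝ) ≠ 0 := by positivity
  field_simp

lemma mixedErlangPDF_add (N : ℕ) (κ : ℕ → ℝ) (μ u y : ℝ) :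
    mixedErlangPDF N κ μ (u + y) = ∑ n ∈ Finset.Icc 1 N, κ n * (μ ^ n * Real.exp (-(μ * u)) *
      ∑ i ∈ Finset.range n, 1 / (i.factorial : ℝ) *
        (u ^ (n - 1 - i) / ((n - 1 - i).factorial : ℝ)) * (y ^ i * Real.exp (-(μ * y)))) := by
  refine Finset.sum_congr rfl fun n hn => ?_
  obtain ⟨m, rfl⟩ := Nat.exists_eq_add_of_le' (Finset.mem_Icc.1 hn).1
  simp only [← mul_assoc _ _ (Real.exp (-(μ * y))), ← Finset.sum_mul, Nat.add_sub_cancel]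
  rw [add_pow_div_factorial, mul_add, neg_add, Real.exp_add]
  ring

lemma integrable_mixedErlangPDF_add {η : Measure ℝ} [IsProbabilityMeasure η]
    (hη : ∀ᵐ y ∂η, 0 ≤ y) (N : ℕ) (κ : ℕ → ℝ) {μ : ℝ} (hμ : 0 < μ) (u : ℝ) :
    Integrable (fun y => mixedErlangPDF N κ μ (u + y)) η := by
  simp only [mixedErlangPDF_add]
  exact integrable_finsetSum _ fun n _ => ((integrable_finsetSum _ fun i _ =>
    (integrable_pow_mul_exp hη hμ i).const_mul _).const_mul _).const_mul _

/-- The claimed density at `u` is `E [g (u + W + A)]`, with `g` the density of `B`. -/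
lemma waitingDensity_eq_integral {ν α : Measure ℝ} [IsProbabilityMeasure ν]
    [IsProbabilityMeasure α] (h : ∀ᵐ y ∂sumLaw ν α, 0 ≤ y) (N : ℕ) (κ : ℕ → ℝ) {μ : ℝ}
    (hμ : 0 < μ) (u : ℝ) :
    waitingDensity N κ μ (phi ν α) u = ∫ y, mixedErlangPDF N κ μ (u + y) ∂sumLaw ν α := by
  have hi := fun i => integrable_pow_mul_exp h hμ i
  simp only [mixedErlangPDF_add, waitingDensity, erlangDensity, iteratedDeriv_phi h hμ]
  rw [integral_finsetSum _ fun n _ => ((integrable_finsetSum _ fun i _ =>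
    (hi i).const_mul _).const_mul _).const_mul _]
  refine Finset.sum_congr rfl fun n _ => ?_
  rw [integral_const_mul, integral_const_mul, integral_finsetSum _ fun i _ => (hi i).const_mul _]
  congr 2
  refine Finset.sum_congr rfl fun i _ => ?_
  rw [integral_const_mul, div_eq_mul_inv, mul_comm ((-1 : ℝ) ^ i), mul_assoc _ ((-1 : ℝ) ^ i),
    neg_one_pow_mul_self]
  ring

lemma waitingDensity_nonneg {ν α : Measure ℝ} [IsProbabilityMeasure ν]
    [IsProbabilityMeasure α] (h : ∀ᵐ y ∂sumLaw ν α, 0 ≤ y) {N : ℕ} {κ : ℕ → ℝ} {μ : ℝ}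
    (hμ : 0 < μ) (hκ : ∀ n ∈ Finset.Icc 1 N, 0 ≤ κ n) {u : ℝ} (hu : 0 ≤ u) :
    0 ≤ waitingDensity N κ μ (phi ν α) u := by
  rw [waitingDensity_eq_integral h N κ hμ]
  exact integral_nonneg_of_ae (h.mono fun y hy => mixedErlangPDF_nonneg hμ hκ (add_nonneg hu hy))

/-- The claimed mass at zero is `E [F (Y)]`, with `F` the distribution function of `B` and `Y`
distributed as `W + A`. -/
lemma massAtZero_eq_integral {ν α : Measure ℝ} [IsProbabilityMeasure ν]
    [IsProbabilityMeasure α] (h : ∀ᵐ y ∂sumLaw ν α, 0 ≤ y) {N : ℕ} {κ : ℕ → ℝ} {μ : ℝ}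
    (hμ : 0 < μ) (hκ_sum : ∑ n ∈ Finset.Icc 1 N, κ n = 1) :
    massAtZero N κ μ (phi ν α) = ∫ y, mixedErlangCDF N κ μ y ∂sumLaw ν α := by
  have hi := fun i => integrable_pow_mul_exp h hμ i
  have hexpand : ∀ y, mixedErlangCDF N κ μ y = 1 - ∑ n ∈ Finset.Icc 1 N, ∑ i ∈ Finset.range n,
      κ n * (μ ^ i / (i.factorial : ℝ)) * (y ^ i * Real.exp (-(μ * y))) := by
    intro y
    rw [mixedErlangCDF]
    conv_rhs => rw [← hκ_sum]
    rw [← Finset.sum_sub_distrib]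
    refine Finset.sum_congr rfl fun n _ => ?_
    rw [mul_sub, mul_one, Finset.mul_sum, Finset.mul_sum]
    congr 1
    refine Finset.sum_congr rfl fun i _ => ?_
    rw [mul_pow]
    ring
  simp only [hexpand]
  rw [integral_sub (integrable_const _) (integrable_finsetSum _ fun n _ =>
      integrable_finsetSum _ fun i _ => (hi i).const_mul _),
    integral_finsetSum _ fun n _ => integrable_finsetSum _ fun i _ => (hi i).const_mul _]
  simp only [integral_const, probReal_univ, smul_eq_mul, mul_one, massAtZero]
  congr 1
  refine Finset.sum_congr rfl fun n _ => ?_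
  rw [integral_finsetSum _ fun i _ => (hi i).const_mul _]
  refine Finset.sum_congr rfl fun i _ => ?_
  have hsign : (-1 : ℝ) ^ i * (-1) ^ i = 1 := by rw [← mul_pow]; simp
  rw [integral_const_mul, iteratedDeriv_phi h hμ, neg_pow]
  linear_combination (κ n * (μ ^ i / (i.factorial : ℝ)) *
    ∫ y, y ^ i * Real.exp (-(μ * y)) ∂sumLaw ν α) * hsign

lemma map_prod_eq_sumLaw_prod (ν α β : Measure ℝ) [IsProbabilityMeasure ν]
    [IsProbabilityMeasure α] [IsProbabilityMeasure β] :
    (ν.prod (α.prod β)).map (fun p : ℝ × ℝ × ℝ => (p.1 + p.2.1, p.2.2)) =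
      (sumLaw ν α).prod β := by
  have h := Measure.map_prod_map (ν.prod α) β
    (show Measurable fun q : ℝ × ℝ => q.1 + q.2 by fun_prop) measurable_id
  rw [Measure.map_id] at h
  rw [sumLaw, h, ← Measure.prodAssoc_prod, Measure.map_map (by fun_prop) (by fun_prop)]
  rfl

/-- An equilibrium law is the law of `max 0 (B - Y)`, with `Y` distributed as `W + A`. -/
lemma eq_reflect_sumLaw {α β ν : Measure ℝ} [IsProbabilityMeasure ν] [IsProbabilityMeasure α]
    [IsProbabilityMeasure β] (h : reflect (gapLaw α β) ν = ν) :
    ν = reflect β (sumLaw ν α) := by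
  conv_lhs => rw [← h, ← map_prod_eq_reflect]
  rw [reflect, ← map_prod_eq_sumLaw_prod, Measure.map_map measurable_reflect_map (by fun_prop)]
  congr 1
  ext p
  simp only [Function.comp]
  congr 1
  ring

lemma reflect_singleton_zero (η β : Measure ℝ) :
    reflect β η {0} = (η.prod β) {q : ℝ × ℝ | q.2 ≤ q.1} := by
  rw [reflect, Measure.map_apply measurable_reflect_map (measurableSet_singleton 0)]
  congr 1
  ext q
  simp

/-- Ties `B = Y` have probability zero when the law of `B` has no atoms. -/
lemma prod_setOf_le_eq_lt {η β : Measure ℝ} [SFinite β] [NullSingletonClass β] :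
    (η.prod β) {q : ℝ × ℝ | q.2 ≤ q.1} = (η.prod β) {q : ℝ × ℝ | q.2 < q.1} := by
  rw [Measure.prod_apply (measurableSet_le measurable_snd measurable_fst),
    Measure.prod_apply (measurableSet_lt measurable_snd measurable_fst)]
  exact lintegral_congr fun y => (measure_congr Iio_ae_eq_Iic).symm

lemma reflect_real_singleton_zero {η β : Measure ℝ} [IsProbabilityMeasure β] :
    (reflect β η).real {0} = ∫ y, cdf β y ∂η := by
  rw [measureReal_def, reflect_singleton_zero,
    Measure.prod_apply (measurableSet_le measurable_snd measurable_fst), ← integral_toReal]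
  · exact integral_congr_ae (ae_of_all _ fun y => (cdf_eq_real β y).symm)
  · exact (measurable_measure_prodMk_left
      (measurableSet_le measurable_snd measurable_fst)).aemeasurable
  · exact ae_of_all _ fun _ => measure_lt_top _ _

/-- If `B` has density `g` on `(0, ∞)` and `Y ≥ 0` is independent of `B`, then `max 0 (B - Y)` has
density `u ↦ E [g (u + Y)]` on `(0, ∞)`. -/
lemma restrict_reflect_eq_withDensity {η β : Measure ℝ} [IsProbabilityMeasure η]
    [IsProbabilityMeasure β] {g : ℝ → ENNReal} (hg : Measurable g)
    (hβ : β = (volume.restrict (Set.Ioi 0)).withDensity g) (hη : ∀ᵐ y ∂η, 0 ≤ y) :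
    (reflect β η).restrict (Set.Ioi 0) =
      (volume.restrict (Set.Ioi 0)).withDensity fun u => ∫⁻ y, g (u + y) ∂η := by
  ext s hs
  have hs0 : MeasurableSet (s ∩ Set.Ioi 0) := hs.inter measurableSet_Ioi
  rw [Measure.restrict_apply hs, withDensity_apply _ hs, Measure.restrict_restrict hs, reflect,
    Measure.map_apply measurable_reflect_map hs0,
    Measure.prod_apply (measurable_reflect_map hs0), lintegral_lintegral_swap (by fun_prop)]
  refine lintegral_congr_ae ?_
  filter_upwards [hη] with y hy
  have hset : Prod.mk y ⁻¹' ((fun p : ℝ × ℝ => max 0 (p.2 - p.1)) ⁻¹' (s ∩ Set.Ioi 0)) =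
      (fun b => b - y) ⁻¹' (s ∩ Set.Ioi 0) := by
    ext b
    simp only [Set.mem_preimage, Set.mem_inter_iff, Set.mem_Ioi, lt_max_iff, lt_self_iff_false,
      false_or]
    refine and_congr_left fun hb => ?_
    rw [max_eq_right hb.le]
  have hmeas : MeasurableSet ((fun b => b - y) ⁻¹' (s ∩ Set.Ioi 0)) :=
    (measurable_id.sub_const y) hs0
  have hsub : (fun b => b - y) ⁻¹' (s ∩ Set.Ioi 0) ⊆ Set.Ioi 0 := fun b hb =>
    hy.trans_lt (sub_pos.1 hb.2)
  rw [hset]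
  conv_lhs => rw [hβ]
  rw [withDensity_apply _ hmeas, Measure.restrict_restrict hmeas,
    Set.inter_eq_left.2 hsub, ← lintegral_indicator hmeas, ← lintegral_indicator hs0,
    ← lintegral_add_right_eq_self _ y]
  refine lintegral_congr fun u => ?_
  have hiff : u + y ∈ (fun b => b - y) ⁻¹' (s ∩ Set.Ioi 0) ↔ u ∈ s ∩ Set.Ioi 0 := by
    rw [Set.mem_preimage, add_sub_cancel_right]
  by_cases hu : u ∈ s ∩ Set.Ioi 0
  · rw [Set.indicator_of_mem hu, Set.indicator_of_mem (hiff.2 hu)]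
  · rw [Set.indicator_of_notMem hu, Set.indicator_of_notMem (mt hiff.1 hu)]

/-- A law on `[0, ∞)` is the sum of its atom at zero and its restriction to `(0, ∞)`. -/
lemma eq_atom_add_restrict {ν : Measure ℝ} (h : ν (Set.Iio 0) = 0) :
    ν = ν {0} • Measure.dirac 0 + ν.restrict (Set.Ioi 0) := by
  have h1 : ν.restrict (Set.Iic 0) = ν.restrict {0} := by
    refine Measure.restrict_congr_set ?_
    rw [← Set.Iio_union_right]
    exact union_ae_eq_right_of_ae_eq_empty (ae_eq_empty.2 h)
  rw [← Measure.restrict_singleton, ← h1, ← Set.compl_Iic,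
    Measure.restrict_add_restrict_compl measurableSet_Iic]

/-! ### Convergence in distribution -/

/-- Convergence of the distribution functions at every point implies weak convergence. -/
lemma tendsto_of_tendsto_real_Iic {p : ℕ → ProbabilityMeasure ℝ} {ν : ProbabilityMeasure ℝ}
    (h : ∀ x, Tendsto (fun n => (p n : Measure ℝ).real (Set.Iic x)) atTop
      (𝓝 ((ν : Measure ℝ).real (Set.Iic x)))) : Tendsto p atTop (𝓝 ν) := by
  refine (isPiSystem_Ioc (id : ℝ → ℝ) (id : ℝ → ℝ)).tendsto_probabilityMeasure_of_tendsto_of_mem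
    ?_ ?_ ?_
  · rintro _ ⟨a, b, -, rfl⟩
    exact measurableSet_Ioc
  · intro u hu x hx
    obtain ⟨ε, hε, hball⟩ := Metric.isOpen_iff.1 hu x hx
    refine ⟨Set.Ioc (x - ε / 2) (x + ε / 2), ⟨_, _, by simp only [id]; linarith, rfl⟩,
      Ioc_mem_nhds (by linarith) (by linarith), fun y hy => hball ?_⟩
    rw [Metric.mem_ball, Real.dist_eq, abs_lt]
    constructor <;> linarith [hy.1, hy.2]
  · rintro _ ⟨a, b, hab, rfl⟩
    have key (ρ : ProbabilityMeasure ℝ) : (ρ : Measure ℝ).real (Set.Ioc a b) =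
        (ρ : Measure ℝ).real (Set.Iic b) - (ρ : Measure ℝ).real (Set.Iic a) := by
      have hab' : a ≤ b := le_of_lt hab
      rw [← Set.Iic_sdiff_Iic, measureReal_sdiff (Set.Iic_subset_Iic.2 hab')
        measurableSet_Iic]
    rw [← NNReal.tendsto_coe]
    have := (h b).sub (h a)
    simp only [← key] at this
    exact this

end AlternatingService

theorem theorem2 {Ω : Type*} [MeasurableSpace Ω] (P : Measure Ω) [IsProbabilityMeasure P]
    (α β : Measure ℝ) [IsProbabilityMeasure α] [IsProbabilityMeasure β]
    (A B W : ℕ → Ω → ℝ)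
    (hα : ∀ᵐ a ∂α, 0 ≤ a)
    (N : ℕ) (κ : ℕ → ℝ) (μ : ℝ) (hμ : 0 < μ)
    (hκ_nonneg : ∀ n ∈ Finset.Icc 1 N, 0 ≤ κ n)
    (hκ_sum : ∑ n ∈ Finset.Icc 1 N, κ n = 1)
    (hβ : ∀ x : ℝ, 0 ≤ x → cdf β x = AlternatingService.mixedErlangCDF N κ μ x)
    (hW : AlternatingService.IsWaitingProcess P α β A B W) :
    ∃ ν : Measure ℝ, ∃ _ : IsProbabilityMeasure ν,
      -- `ν` is the limiting distribution of the waiting times and the only equilibrium law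
      TendstoInDistribution W atTop (id : ℝ → ℝ) (fun _ => P) ν ∧
      (∀ ν' : Measure ℝ, AlternatingService.IsStationaryLaw α β ν' ↔ ν' = ν) ∧
      -- the derivatives of `φ` at `μ` exist
      ContDiffAt ℝ ∞ (AlternatingService.phi ν α) μ ∧
      -- the mass at zero
      ν.real {0} = (ν.prod (α.prod β)).real {p : ℝ × ℝ × ℝ | p.2.2 < p.1 + p.2.1} ∧
      ν.real {0} = AlternatingService.massAtZero N κ μ (AlternatingService.phi ν α) ∧
      -- the density on `[0, ∞)` of the remaining part
      (∀ x : ℝ, 0 ≤ x →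
        0 ≤ AlternatingService.waitingDensity N κ μ (AlternatingService.phi ν α) x) ∧
      ν = ν {0} • Measure.dirac 0 +
        (volume.restrict (Set.Ici 0)).withDensity (fun x => ENNReal.ofReal
          (AlternatingService.waitingDensity N κ μ (AlternatingService.phi ν α) x)) := by
  have hac := AlternatingService.restrict_absolutelyContinuous_of_cdf hμ hκ_nonneg hκ_sum hβ
  have hdens := AlternatingService.eq_withDensity_of_cdf hμ hκ_nonneg hβ
  obtain ⟨ν, hν, hfix, huniq, hconv⟩ := AlternatingService.exists_unique_invariant
    (ξ := AlternatingService.gapLaw α β) one_pos (AlternatingService.gapLaw_Ici_one_lt hα hac)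
    (AlternatingService.gapLaw_Ici_pos hac _)
  have hν0 : ν (Set.Iio 0) = 0 := hfix ▸ AlternatingService.reflect_Iio_zero _ ν
  have hν_nonneg : ∀ᵐ w ∂ν, 0 ≤ w := by
    filter_upwards [measure_eq_zero_iff_ae_notMem.1 hν0] with w hw
    simpa using hw
  have hη := AlternatingService.ae_nonneg_sumLaw hν_nonneg hα
  have hrefl := AlternatingService.eq_reflect_sumLaw hfix
  have hatoms : NullSingletonClass β := by
    rw [hdens]; infer_instance
  have hg : Measurable fun x => ENNReal.ofReal (AlternatingService.mixedErlangPDF N κ μ x) :=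
    (AlternatingService.continuous_mixedErlangPDF N κ μ).measurable.ennreal_ofReal
  refine ⟨ν, hν, ?_, fun ν' => ⟨fun h => ?_, ?_⟩, AlternatingService.contDiffAt_phi hη hμ, ?_, ?_,
    fun x hx => AlternatingService.waitingDensity_nonneg hη hμ hκ_nonneg hx, ?_⟩
  · have hm := fun n => (hW.measurable_waiting n).aemeasurable (μ := P)
    refine ⟨hm, aemeasurable_id, AlternatingService.tendsto_of_tendsto_real_Iic fun x => ?_⟩
    have h0 : P.map (W 0) (Set.Iio 0) = 0 := by
      rw [Measure.map_apply hW.measurable_init measurableSet_Iio, measure_eq_zero_iff_ae_notMem]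
      filter_upwards [hW.init_nonneg] with o ho
      simpa using ho
    simpa using hconv (fun n => P.map (W n)) (fun n => Measure.isProbabilityMeasure_map (hm n)) h0
      hW.map_waiting_succ x
  · have := h.1
    exact huniq ν' this ((AlternatingService.map_prod_eq_reflect α β ν').symm.trans h.2)
  · rintro rfl
    exact ⟨hν, (AlternatingService.map_prod_eq_reflect α β ν').trans hfix⟩
  · conv_lhs => rw [hrefl]
    rw [measureReal_def, AlternatingService.reflect_singleton_zero,
      AlternatingService.prod_setOf_le_eq_lt, ← AlternatingService.map_prod_eq_sumLaw_prod,
      Measure.map_apply (by fun_prop) (measurableSet_lt measurable_snd measurable_fst)]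
    rfl
  · rw [AlternatingService.massAtZero_eq_integral hη hμ hκ_sum]
    conv_lhs => rw [hrefl]
    rw [AlternatingService.reflect_real_singleton_zero]
    exact integral_congr_ae (hη.mono fun y hy => hβ y hy)
  · have h1 := AlternatingService.restrict_reflect_eq_withDensity hg hdens hη
    rw [← hrefl] at h1
    conv_lhs => rw [AlternatingService.eq_atom_add_restrict hν0, h1]
    rw [← restrict_Ioi_eq_restrict_Ici]
    congr 1
    refine withDensity_congr_ae ?_
    filter_upwards [ae_restrict_mem measurableSet_Ioi] with u hu
    rw [AlternatingService.waitingDensity_eq_integral hη N κ hμ,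
      ofReal_integral_eq_lintegral_ofReal
        (AlternatingService.integrable_mixedErlangPDF_add hη N κ hμ u)
        (hη.mono fun y hy => AlternatingService.mixedErlangPDF_nonneg hμ hκ_nonneg
          (add_nonneg (le_of_lt hu) hy))]
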